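/- **Setting.** In rounds $t=1,2,\dots$ of a repeated first-price auction a bidder submits a bid $B_t$ while the highest opposing bid is $M_t$; she wins if and only if $M_t\le B_t$, and she observes the value $V_t$ of the item if and only if she wins. The $V_t$ are i.i.d. in $[0,1]$ with mean $v$; the $M_t$ are i.i.d. in $[0,1]$ with cumulative distribution function $F$, which the bidder knows; and $(V_t)_{t\ge1}$ is independent of $(M_t)_{t\ge1}$. Let $U_{v,F}(b)=(v-b)F(b)$, and let $b^*=\max\operatorname{argmax}_{b\in[0,1]}U_{v,F}(b)$ be the largest optimal bid; it is assumed that $b^*$ exists (the argmax has a largest element) and that $F(b^*)>0$. The (pseudo-)regret after $T$ rounds is $$R_T^{v,F}=T\max_{b\in[0,1]}U_{v,F}(b)-\sum_{t=1}^T\mathbb E\big[U_{v,F}(B_t)\big].$$ **Algorithm UCBid1** with parameter $\gamma$. Let $N_t=\sum_{s=1}^{t-1}\mathbf 1\{M_s\le B_s\}$, $\hat V_t=\frac1{N_t}\sum_{s=1}^{t-1}V_s\mathbf 1\{M_s\le B_s\}$ and $\epsilon_t=\sqrt{\gamma\log(t-1)/(2N_t)}$. Bid $B_1=1$ and, for $t\ge2$,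 $$B_t=\max\operatorname{argmax}_{b\in[0,1]}\,(\hat V_t+\epsilon_t-b)F(b),$$ where the maximum is replaced by the supremum of the argmax set in case this set has no largest element. **Theorem.** For every $\gamma>1$, the regret of UCBid1 satisfies $$R_T^{v,F}\le\frac{\sqrt{2\gamma}}{F(b^*)}\sqrt{T\log T}+O(\log T),$$ that is, there is a constant $C$ depending only on $\gamma$, $v$ and $F$ such that $R_T^{v,F}\le\frac{\sqrt{2\gamma}}{F(b^*)}\sqrt{T\log T}+C\log T$ for all integers $T\ge2$. -/

import Mathlib

open MeasureTheory ProbabilityTheory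

namespace FirstPrice

noncomputable section

/-- First-price utility `U_{v,F}(b) = (v - b) F(b)` of a bid `b`, where `v` is the expected value
of the item and `F` is the CDF of the highest opposing bid. -/
def utility (F : ℝ → ℝ) (v b : ℝ) : ℝ := (v - b) * F b

/-- The set `argmax_{b ∈ [0,1]} U_{v,F}(b)`. -/
def argmaxBids (F : ℝ → ℝ) (v : ℝ) : Set ℝ :=
  {b | b ∈ Set.Icc (0 : ℝ) 1 ∧ ∀ b' ∈ Set.Icc (0 : ℝ) 1, utility F v b' ≤ utility F v b}

/-- The largest maximizer of `U_{w,F}` on `[0,1]`. When the set of maximizers has no largest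
element (for `w ≥ 0` and `F` the CDF of a law on `[0,1]` this happens only if `F` has an atom at
the left end of its support and `w` is below it), this is the supremum of that set. -/
def largestArgmax (F : ℝ → ℝ) (w : ℝ) : ℝ := sSup (argmaxBids F w)

/-! Rounds are numbered from `0`, so that `t` is the number of rounds played before round `t`.
`V s`, `M s`, `B s` are the value of the item, the highest opposing bid and the submitted bid in
round `s`. -/

/-- Number of auctions won (equivalently, of values observed) before round `t`. -/
def numObs (M B : ℕ → ℝ) (t : ℕ) : ℝ :=
  ∑ s ∈ Finset.range t, if M s ≤ B s then 1 else 0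

/-- Average of the values observed before round `t`. -/
def meanObs (V M B : ℕ → ℝ) (t : ℕ) : ℝ :=
  (∑ s ∈ Finset.range t, if M s ≤ B s then V s else 0) / numObs M B t

/-- Confidence bonus in round `t`. -/
def bonus (γ : ℝ) (M B : ℕ → ℝ) (t : ℕ) : ℝ :=
  √(γ * Real.log t / (2 * numObs M B t))

/-- The bids of UCBid1 along a realization `V`, `M`: bid `1` in the first round, and afterwards
the largest maximizer over `[0,1]` of `b ↦ (mean + bonus - b) F(b)`. The function `B` below is
the history of bids before round `t`. -/
def ucbid1 (F : ℝ → ℝ) (γ : ℝ) (V M : ℕ → ℝ) (t : ℕ) : ℝ :=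
  if t = 0 then 1 else
    let B : ℕ → ℝ := fun s => if _h : s < t then ucbid1 F γ V M s else 0
    largestArgmax F (meanObs V M B t + bonus γ M B t)
termination_by t

theorem ucbid1_zero (F : ℝ → ℝ) (γ : ℝ) (V M : ℕ → ℝ) : ucbid1 F γ V M 0 = 1 := by
  rw [ucbid1]; simp

theorem ucbid1_of_pos (F : ℝ → ℝ) (γ : ℝ) (V M : ℕ → ℝ) {t : ℕ} (ht : 0 < t) :
    ucbid1 F γ V M t =
      largestArgmax F
        (meanObs V M (ucbid1 F γ V M) t + bonus γ M (ucbid1 F γ V M) t) := by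
  have hN : numObs M (fun s => if _h : s < t then ucbid1 F γ V M s else 0) t =
      numObs M (ucbid1 F γ V M) t := by
    unfold numObs
    refine Finset.sum_congr rfl fun s hs => ?_
    simp [Finset.mem_range.mp hs]
  have hS : meanObs V M (fun s => if _h : s < t then ucbid1 F γ V M s else 0) t =
      meanObs V M (ucbid1 F γ V M) t := by
    unfold meanObs
    rw [hN]
    congr 1
    refine Finset.sum_congr rfl fun s hs => ?_
    simp [Finset.mem_range.mp hs]
  rw [ucbid1, if_neg ht.ne']
  simp only [bonus, hN, hS]

/-- The (pseudo-)regret after `T` rounds of the bid process `B`. -/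
def regret {Ω : Type*} [MeasurableSpace Ω] (P : Measure Ω) (F : ℝ → ℝ) (v : ℝ)
    (B : ℕ → Ω → ℝ) (T : ℕ) : ℝ :=
  T * (⨆ b : Set.Icc (0 : ℝ) 1, utility F v b)
    - ∑ t ∈ Finset.range T, ∫ ω, utility F v (B t ω) ∂P

end

end FirstPrice

/-! The argument is optimism plus the fact that observations cost only wins. Whenever the empirical
mean is within the bonus of `v`, the optimistic value `w` lies between `v` and `v` plus twice the
bonus. Exchange arguments then give a bid `B ≥ b*`, and optimality of `B` for `w` bounds the
instantaneous regret by `(w - v)(F(B) - F(b*))` (`largestArgmax_spec`). Since `F ≤ 1`, the second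
factor is at most `(1 - F(b*)) F(B)`.

The surviving factor `F(B)` is the conditional probability of winning the round, so in expectation
`F(B_t)/√N_t` may be replaced by `1/√N_t` on won rounds (`integral_cdf_mul_inv_sqrt`). Along every
path with `M 0 ≤ 1` these terms sum to at most `4√T`, because `N` increases by one at each win. The
leading constant is `4(1 - F(b*))√(2γ)`, and `4x(1 - x) ≤ 1` turns it into `√(2γ)/F(b*)`.

The number of observations is random, so the confidence bound needs a self-normalized inequality
(`measureReal_deviation_le`): an exponential supermartingale from Hoeffding's lemma, combined with
peeling over `√N`. With grid ratio `1 + s` the failure probability is of order `log t · t^(-γ(1 -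
s²))`. As `γ > 1`, a small `s` makes this summable, so the remainder is in fact bounded. -/

namespace FirstPrice

/-! ### Optimal bids: existence, monotonicity in the value, cost of overestimation. -/

section Argmax

/-- Exchange argument: maximizers are monotone in the value, provided the larger value's maximizer
wins with positive probability. -/
theorem argmaxBids_le_of_lt {F : ℝ → ℝ} (hmono : Monotone F) {w w' b b' : ℝ} (hw : w < w')
    (hb : b ∈ argmaxBids F w) (hb' : b' ∈ argmaxBids F w') (hF : 0 < F b') : b ≤ b' := by
  by_contra! hlt
  have h1 := hb.2 b' hb'.1
  have h2 := hb'.2 b hb.1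
  unfold utility at h1 h2
  have h3 : F b' ≤ F b := hmono hlt.le
  -- Adding the two optimality inequalities gives `(w' - w)(F b' - F b) ≥ 0`, so `F` takes the same
  -- value at both bids. The lower bid then wins as often at a lower price, which contradicts
  -- optimality of `b`.
  have h4 : F b = F b' := by
    refine le_antisymm ?_ h3
    by_contra! h
    nlinarith [mul_pos (sub_pos.2 hw) (sub_pos.2 h)]
  rw [h4] at h1
  nlinarith [mul_pos (sub_pos.2 hlt) hF]

/-- As above, when the smaller value's maximizer wins with positive probability and is the
greatest one. -/
theorem le_of_isGreatest_argmaxBids {F : ℝ → ℝ} (hmono : Monotone F) {w w' b b' : ℝ} (hw : w ≤ w')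
    (hb : IsGreatest (argmaxBids F w) b) (hb' : IsGreatest (argmaxBids F w') b') (hF : 0 < F b) :
    b ≤ b' := by
  rcases hw.eq_or_lt with rfl | hw
  · exact hb'.2 hb.1
  by_contra! hlt
  have h1 := hb.1.2 b' hb'.1.1
  have h2 := hb'.1.2 b hb.1.1
  unfold utility at h1 h2
  have h3 : F b' ≤ F b := hmono hlt.le
  have h4 : F b' = F b := by
    refine le_antisymm h3 ?_
    by_contra! h
    nlinarith [mul_pos (sub_pos.2 hw) (sub_pos.2 h)]
  rw [h4] at h1
  nlinarith [mul_pos (sub_pos.2 hlt) hF]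

/-- A nondecreasing right-continuous `F` is upper semicontinuous, and a nonnegative continuous
factor preserves this. The positive part is needed: a negative factor would reverse the jumps. -/
theorem upperSemicontinuous_posPart_utility (F : StieltjesFunction ℝ) (w : ℝ) :
    UpperSemicontinuous fun b => max (w - b) 0 * F b := by
  intro x y hy
  have hc : Filter.Tendsto (fun z => F (max z x)) (nhds x) (nhds (F x)) := by
    have h1 : Filter.Tendsto (fun z => max z x) (nhds x) (nhdsWithin x (Set.Ici x)) := by
      refine tendsto_nhdsWithin_iff.2 ⟨?_, .of_forall fun z => le_max_right z x⟩
      have : Continuous fun z : ℝ => max z x := by fun_prop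
      simpa using this.tendsto x
    exact (F.right_continuous x).tendsto.comp h1
  have hd : Filter.Tendsto (fun z => max (w - z) 0) (nhds x) (nhds (max (w - x) 0)) := by
    have : Continuous fun z : ℝ => max (w - z) 0 := by fun_prop
    exact this.tendsto x
  filter_upwards [(hd.mul hc).eventually_lt_const hy] with z hz
  exact lt_of_le_of_lt
    (mul_le_mul_of_nonneg_left (F.mono (le_max_left z x)) (le_max_right _ _)) hz

/-- If some bid has positive utility, there is a greatest optimal bid, and it wins with positive
probability. -/
theorem exists_isGreatest_argmaxBids (F : StieltjesFunction ℝ) (hF0 : ∀ x, 0 ≤ F x) {w b₀ : ℝ}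
    (hb₀ : b₀ ∈ Set.Icc (0 : ℝ) 1) (hpos : 0 < utility F w b₀) :
    ∃ b, IsGreatest (argmaxBids F w) b ∧ 0 < F b := by
  set g : ℝ → ℝ := fun b => max (w - b) 0 * F b with hg
  have husc : UpperSemicontinuous g := upperSemicontinuous_posPart_utility F w
  have hle : ∀ b, utility F w b ≤ g b := fun b =>
    mul_le_mul_of_nonneg_right (le_max_left _ _) (hF0 b)
  have heq : ∀ b, 0 < g b → utility F w b = g b := by
    intro b hb
    have : 0 < w - b := by
      by_contra! h
      simp [hg, max_eq_right h] at hb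
    simp [hg, utility, max_eq_left this.le]
  obtain ⟨c, hc, hmax⟩ := (husc.upperSemicontinuousOn (Set.Icc 0 1)).exists_isMaxOn
    ⟨b₀, hb₀⟩ isCompact_Icc
  have hgc : 0 < g c := hpos.trans_le ((hle b₀).trans (hmax hb₀))
  -- Since the maximum of `g` is positive, and `g` agrees with the utility wherever it is positive,
  -- the argmax is a superlevel set of `g`, hence compact.
  have hset : argmaxBids F w = Set.Icc 0 1 ∩ {b | g c ≤ g b} := by
    ext b
    constructor
    · rintro ⟨hb, h⟩
      refine ⟨hb, ?_⟩
      have := h c hc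
      rw [heq c hgc] at this
      exact this.trans (hle b)
    · rintro ⟨hb, h⟩
      refine ⟨hb, fun b' hb' => ?_⟩
      rw [heq b (hgc.trans_le h)]
      exact (hle b').trans ((hmax hb').trans h)
  have hcompact : IsCompact (argmaxBids F w) := by
    rw [hset]
    exact isCompact_Icc.inter_right (husc.isClosed_preimage (g c))
  have hne : (argmaxBids F w).Nonempty := ⟨c, by rw [hset]; exact ⟨hc, le_refl (g c)⟩⟩
  obtain ⟨b, hb⟩ := hcompact.exists_isGreatest hne
  refine ⟨b, hb, ?_⟩
  have h1 := hb.1.2 b₀ hb₀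
  refine (hF0 b).lt_of_ne fun h => ?_
  have : utility F w b = 0 := by simp [utility, ← h]
  linarith

theorem largestArgmax_mem_Icc (F : ℝ → ℝ) (w : ℝ) : largestArgmax F w ∈ Set.Icc (0 : ℝ) 1 :=
  ⟨Real.sSup_nonneg fun _ hb => hb.1.1, Real.sSup_le (fun _ hb => hb.1.2) zero_le_one⟩

theorem le_largestArgmax {F : ℝ → ℝ} {w b : ℝ} (hb : b ∈ argmaxBids F w) :
    b ≤ largestArgmax F w :=
  le_csSup ⟨1, fun _ h => h.1.2⟩ hb

/-- Supplies the measurability of the bids. All real `w` must be treated, including those for which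
the argmax is empty or has no largest element; the former gives `sSup ∅ = 0`. -/
theorem monotone_largestArgmax (F : StieltjesFunction ℝ) (hF0 : ∀ x, 0 ≤ F x) :
    Monotone (largestArgmax F) := by
  intro w w' hw
  rcases hw.eq_or_lt with rfl | hw
  · exact le_rfl
  refine Real.sSup_le (fun b hb => ?_) (largestArgmax_mem_Icc F w').1
  by_cases hP : ∃ b₀ ∈ Set.Icc (0 : ℝ) 1, 0 < utility F w' b₀
  · obtain ⟨b₀, hb₀, hpos⟩ := hP
    obtain ⟨b', hb', hF'⟩ := exists_isGreatest_argmaxBids F hF0 hb₀ hpos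
    exact (argmaxBids_le_of_lt F.mono hw hb hb'.1 hF').trans (le_largestArgmax hb'.1)
  push Not at hP
  rcases (hF0 b).eq_or_lt with hFb | hFb
  · exact le_largestArgmax ⟨hb.1, fun b' hb' => by simpa [utility, ← hFb] using hP b' hb'⟩
  rcases hb.1.1.eq_or_lt with rfl | hb0
  · exact (largestArgmax_mem_Icc F w').1
  -- Here `w < w' ≤ b`, so `b` has negative utility at `w`, and bidding `0` does strictly better for
  -- either sign of `w`.
  exfalso
  have hwb : w' ≤ b := by
    by_contra! h
    exact (hP b hb.1).not_gt (mul_pos (sub_pos.2 h) hFb)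
  have h0 := hb.2 0 ⟨le_rfl, zero_le_one⟩
  simp only [utility, sub_zero] at h0
  have h1 : F 0 ≤ F b := F.mono hb0.le
  rcases le_or_gt 0 w with hw0 | hw0
  · nlinarith [mul_nonneg hw0 (hF0 0), mul_pos (sub_pos.2 (hw.trans_le hwb)) hFb]
  · nlinarith [mul_pos hb0 hFb]

/-- If the estimated value is at least the true one, UCBid1 bids at least the optimal bid, and
its regret is controlled by the overestimation. -/
theorem largestArgmax_spec (F : StieltjesFunction ℝ) (hF0 : ∀ x, 0 ≤ F x) {v w bstar : ℝ}
    (hv : v ∈ Set.Icc (0 : ℝ) 1)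
    (hb : IsGreatest (argmaxBids F v) bstar) (hF : 0 < F bstar) (hw : v ≤ w) :
    bstar ≤ largestArgmax F w ∧
      utility F v bstar - utility F v (largestArgmax F w) ≤
        (w - v) * (F (largestArgmax F w) - F bstar) := by
  have key : ∃ b, IsGreatest (argmaxBids F w) b := by
    rcases hw.eq_or_lt with rfl | hw
    · exact ⟨bstar, hb⟩
    -- Bidding `v` has utility zero, hence `bstar ≤ v < w` and `bstar` has positive utility at `w`.
    have h1 := hb.1.2 v hv
    simp only [utility, sub_self, zero_mul] at h1
    have h2 : 0 ≤ v - bstar := nonneg_of_mul_nonneg_left h1 hF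
    obtain ⟨b, hb, -⟩ := exists_isGreatest_argmaxBids F hF0 (w := w) hb.1.1
      (mul_pos (by linarith) hF)
    exact ⟨b, hb⟩
  obtain ⟨b, hbw⟩ := key
  have : largestArgmax F w = b := hbw.csSup_eq
  rw [this]
  refine ⟨le_of_isGreatest_argmaxBids F.mono hw hb hbw hF, ?_⟩
  have := hbw.1.2 bstar hb.1.1
  unfold utility at *
  linarith

theorem iSup_utility_eq {F : ℝ → ℝ} {v bstar : ℝ} (hb : bstar ∈ argmaxBids F v) :
    (⨆ b : Set.Icc (0 : ℝ) 1, utility F v b) = utility F v bstar :=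
  le_antisymm (ciSup_le fun b => hb.2 b b.2)
    (le_ciSup (f := fun b : Set.Icc (0 : ℝ) 1 => utility F v b)
      ⟨_, by rintro _ ⟨b, rfl⟩; exact hb.2 b b.2⟩ ⟨bstar, hb.1⟩)

theorem abs_utility_le_one {F : ℝ → ℝ} (hF0 : ∀ x, 0 ≤ F x) (hF1 : ∀ x, F x ≤ 1) {v b : ℝ}
    (hv : v ∈ Set.Icc (0 : ℝ) 1) (hb : b ∈ Set.Icc (0 : ℝ) 1) : |utility F v b| ≤ 1 := by
  rw [utility, abs_mul]
  refine mul_le_one₀ (abs_le.2 ⟨?_, ?_⟩) (abs_nonneg _) (abs_le.2 ⟨?_, hF1 b⟩)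
  · linarith [hv.1, hb.2]
  · linarith [hv.2, hb.1]
  · linarith [hF0 b]

end Argmax

/-! ### Deterministic properties of the bid sequence along a path. -/

section Path

theorem ucbid1_mem_Icc (F : ℝ → ℝ) (γ : ℝ) (V M : ℕ → ℝ) (t : ℕ) :
    ucbid1 F γ V M t ∈ Set.Icc (0 : ℝ) 1 := by
  rcases Nat.eq_zero_or_pos t with rfl | ht
  · simp [ucbid1_zero]
  · rw [ucbid1_of_pos F γ V M ht]
    exact largestArgmax_mem_Icc _ _

/-- The bid of round `t` depends only on the values and opposing bids of earlier rounds. -/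
theorem ucbid1_congr (F : ℝ → ℝ) (γ : ℝ) {V V' M M' : ℕ → ℝ} {t : ℕ}
    (hV : ∀ s < t, V s = V' s) (hM : ∀ s < t, M s = M' s) :
    ucbid1 F γ V M t = ucbid1 F γ V' M' t := by
  induction t using Nat.strong_induction_on with
  | _ t ih =>
  rcases Nat.eq_zero_or_pos t with rfl | ht
  · simp [ucbid1_zero]
  have hB : ∀ s < t, ucbid1 F γ V M s = ucbid1 F γ V' M' s := fun s hs =>
    ih s hs (fun r hr => hV r (hr.trans hs)) (fun r hr => hM r (hr.trans hs))
  have hN : numObs M (ucbid1 F γ V M) t = numObs M' (ucbid1 F γ V' M') t :=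
    Finset.sum_congr rfl fun s hs => by
      rw [hB s (Finset.mem_range.1 hs), hM s (Finset.mem_range.1 hs)]
  have hS : meanObs V M (ucbid1 F γ V M) t = meanObs V' M' (ucbid1 F γ V' M') t := by
    unfold meanObs
    rw [hN]
    congr 1
    exact Finset.sum_congr rfl fun s hs => by
      rw [hB s (Finset.mem_range.1 hs), hM s (Finset.mem_range.1 hs),
        hV s (Finset.mem_range.1 hs)]
  rw [ucbid1_of_pos F γ V M ht, ucbid1_of_pos F γ V' M' ht]
  simp only [bonus, hN, hS]

/-- Number of auctions won by UCBid1 before round `t`. -/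
noncomputable def ucbidWins (F : ℝ → ℝ) (γ : ℝ) (V M : ℕ → ℝ) (t : ℕ) : ℝ :=
  numObs M (ucbid1 F γ V M) t

/-- Sum of the centred values observed by UCBid1 before round `t`. -/
noncomputable def ucbidDeviation (F : ℝ → ℝ) (γ v : ℝ) (V M : ℕ → ℝ) (t : ℕ) : ℝ :=
  ∑ s ∈ Finset.range t, if M s ≤ ucbid1 F γ V M s then V s - v else 0

theorem ucbidWins_congr (F : ℝ → ℝ) (γ : ℝ) {V V' M M' : ℕ → ℝ} {t : ℕ}
    (hV : ∀ s < t, V s = V' s) (hM : ∀ s < t, M s = M' s) :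
    ucbidWins F γ V M t = ucbidWins F γ V' M' t := by
  unfold ucbidWins numObs
  refine Finset.sum_congr rfl fun s hs => ?_
  have hs := Finset.mem_range.1 hs
  rw [ucbid1_congr F γ (fun r hr => hV r (hr.trans hs)) (fun r hr => hM r (hr.trans hs)), hM s hs]

theorem ucbidDeviation_congr (F : ℝ → ℝ) (γ v : ℝ) {V V' M M' : ℕ → ℝ} {t : ℕ}
    (hV : ∀ s < t, V s = V' s) (hM : ∀ s < t, M s = M' s) :
    ucbidDeviation F γ v V M t = ucbidDeviation F γ v V' M' t :=
  Finset.sum_congr rfl fun s hs => by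
    have hs := Finset.mem_range.1 hs
    rw [ucbid1_congr F γ (fun r hr => hV r (hr.trans hs)) (fun r hr => hM r (hr.trans hs)), hM s hs,
      hV s hs]

theorem ucbidWins_succ (F : ℝ → ℝ) (γ : ℝ) (V M : ℕ → ℝ) (t : ℕ) :
    ucbidWins F γ V M (t + 1) =
      ucbidWins F γ V M t + if M t ≤ ucbid1 F γ V M t then 1 else 0 :=
  Finset.sum_range_succ _ _

theorem ucbidDeviation_succ (F : ℝ → ℝ) (γ v : ℝ) (V M : ℕ → ℝ) (t : ℕ) :
    ucbidDeviation F γ v V M (t + 1) =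
      ucbidDeviation F γ v V M t + if M t ≤ ucbid1 F γ V M t then V t - v else 0 :=
  Finset.sum_range_succ _ _

theorem ucbidWins_nonneg (F : ℝ → ℝ) (γ : ℝ) (V M : ℕ → ℝ) (t : ℕ) : 0 ≤ ucbidWins F γ V M t := by
  unfold ucbidWins numObs
  exact Finset.sum_nonneg fun _ _ => by split_ifs <;> simp

theorem ucbidWins_le (F : ℝ → ℝ) (γ : ℝ) (V M : ℕ → ℝ) (t : ℕ) : ucbidWins F γ V M t ≤ t := by
  induction t with
  | zero => simp [ucbidWins, numObs]
  | succ t ih => rw [ucbidWins_succ]; push_cast; split_ifs <;> linarith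

/-- The first auction is won. -/
theorem one_le_ucbidWins (F : ℝ → ℝ) (γ : ℝ) (V M : ℕ → ℝ) (hM : M 0 ≤ 1) {t : ℕ} (ht : 0 < t) :
    1 ≤ ucbidWins F γ V M t := by
  induction t with
  | zero => omega
  | succ t ih =>
    rcases Nat.eq_zero_or_pos t with rfl | ht'
    · rw [ucbidWins_succ, ucbid1_zero, if_pos hM]
      linarith [ucbidWins_nonneg F γ V M 0]
    · rw [ucbidWins_succ]
      have := ih ht'
      split_ifs <;> linarith

theorem meanObs_sub (F : ℝ → ℝ) (γ v : ℝ) (V M : ℕ → ℝ) {t : ℕ} (h : 0 < ucbidWins F γ V M t) :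
    meanObs V M (ucbid1 F γ V M) t - v = ucbidDeviation F γ v V M t / ucbidWins F γ V M t := by
  have : ucbidDeviation F γ v V M t =
      (∑ s ∈ Finset.range t, if M s ≤ ucbid1 F γ V M s then V s else 0)
        - v * ucbidWins F γ V M t := by
    rw [ucbidDeviation, ucbidWins, numObs, Finset.mul_sum, ← Finset.sum_sub_distrib]
    refine Finset.sum_congr rfl fun s _ => ?_
    split_ifs <;> simp
  rw [this, meanObs]
  change _ / ucbidWins F γ V M t - v = _
  field_simp

/-- The inverse square roots of the number of observations, summed over the won auctions. -/
theorem sum_inv_sqrt_ucbidWins_le (F : ℝ → ℝ) (γ : ℝ) (V M : ℕ → ℝ) (hM : M 0 ≤ 1) (t : ℕ) :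
    ∑ s ∈ Finset.range t, (if M s ≤ ucbid1 F γ V M s then (√(ucbidWins F γ V M s))⁻¹ else 0)
      ≤ 4 * √(ucbidWins F γ V M t) := by
  induction t with
  | zero => simp
  | succ t ih =>
    rw [Finset.sum_range_succ, ucbidWins_succ]
    split_ifs with h
    · refine (add_le_add_left ih _).trans ?_
      rcases Nat.eq_zero_or_pos t with rfl | ht
      -- Before the first win the summand is `(√0)⁻¹ = 0`.
      · simp [ucbidWins, numObs]
      have h1 := one_le_ucbidWins F γ V M hM ht
      set n := ucbidWins F γ V M t
      have hn : 1 ≤ √n := Real.one_le_sqrt.2 h1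
      have hs1 := Real.sq_sqrt (show 0 ≤ n by linarith)
      have hs2 := Real.sq_sqrt (show 0 ≤ n + 1 by linarith)
      have hle : √n ≤ √(n + 1) := Real.sqrt_le_sqrt (by linarith)
      -- This makes `4(√(n+1) - √n) = 4/(√(n+1) + √n)` at least `4/(3√n)`, which covers the new term
      -- `1/√n`.
      have hle2 : √(n + 1) ≤ 2 * √n := by
        refine Real.sqrt_le_iff.2 ⟨by linarith, ?_⟩
        nlinarith
      rw [← le_sub_iff_add_le', inv_le_iff_one_le_mul₀ (by linarith)]
      nlinarith
    · simpa using ih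

end Path

/-! ### Independence from the past, and a Chernoff bound. -/

section Independence

/-- Filling the coordinates outside `S` with zeros factors `G` through the finite family indexed by
`S`, which is independent of `X j`. -/
theorem indepFun_of_dependsOn_finset {Ω ι β : Type*} [MeasurableSpace Ω] [MeasurableSpace β]
    {P : Measure Ω} {X : ι → Ω → ℝ} (hX : ∀ i, Measurable (X i)) (hind : iIndepFun X P)
    (S : Finset ι) {j : ι} (hj : j ∉ S) {G : (ι → ℝ) → β} (hG : Measurable G)
    (hdep : ∀ x y, (∀ i ∈ S, x i = y i) → G x = G y) :
    IndepFun (fun ω => G fun i => X i ω) (X j) P := by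
  classical
  have h := hind.indepFun_finset S {j} (Finset.disjoint_singleton_right.2 hj) hX
  have hext : Measurable fun (x : S → ℝ) (i : ι) => if hi : i ∈ S then x ⟨i, hi⟩ else 0 := by
    refine measurable_pi_lambda _ fun i => ?_
    by_cases hi : i ∈ S
    · simpa [hi] using measurable_pi_apply _
    · simp [hi]
  have hpr : Measurable fun x : ({j} : Finset ι) → ℝ => x ⟨j, Finset.mem_singleton_self j⟩ :=
    measurable_pi_apply _
  have h2 := h.comp (hG.comp hext) hpr
  have heq : (fun ω => G fun i => X i ω) =
      (G ∘ fun (x : S → ℝ) (i : ι) => if hi : i ∈ S then x ⟨i, hi⟩ else 0) ∘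
        fun ω (i : S) => X i ω := by
    funext ω
    exact hdep _ _ fun i hi => by simp [hi]
  rw [heq]
  exact h2

/-- Expectation of a bounded weight on the event that an independent variable with law `μ` is
below a threshold. -/
theorem integral_ite_le_eq_integral_mul_cdf {Ω : Type*} [MeasurableSpace Ω] {P : Measure Ω}
    [IsProbabilityMeasure P] {μ : Measure ℝ} [IsProbabilityMeasure μ] {b h X : Ω → ℝ}
    (hb : Measurable b) (hh : Measurable h) (hX : Measurable X) (hbound : ∀ ω, |h ω| ≤ 1)
    (hind : IndepFun (fun ω => (b ω, h ω)) X P) (hlaw : P.map X = μ) :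
    ∫ ω, (if X ω ≤ b ω then h ω else 0) ∂P = ∫ ω, cdf μ (b ω) * h ω ∂P := by
  have hbh : Measurable fun ω => (b ω, h ω) := hb.prodMk hh
  have hmap := (indepFun_iff_map_prod_eq_prod_map_map hbh.aemeasurable hX.aemeasurable).1 hind
  rw [hlaw] at hmap
  let f : (ℝ × ℝ) × ℝ → ℝ := fun z => if z.2 ≤ z.1.1 then z.1.2 else 0
  have hf : Measurable f :=
    Measurable.ite (measurableSet_le (by fun_prop) (by fun_prop)) (by fun_prop) measurable_const
  have hint : Integrable f ((P.map fun ω => (b ω, h ω)).prod μ) := by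
    rw [← hmap, integrable_map_measure hf.aestronglyMeasurable (hbh.prodMk hX).aemeasurable]
    refine Integrable.of_bound (hf.comp (hbh.prodMk hX)).aestronglyMeasurable 1
      (.of_forall fun ω => ?_)
    simp only [f, Function.comp, Real.norm_eq_abs]
    split_ifs
    · exact hbound ω
    · simp
  calc ∫ ω, (if X ω ≤ b ω then h ω else 0) ∂P
      = ∫ z, f z ∂(P.map fun ω => ((b ω, h ω), X ω)) := by
        rw [integral_map (hbh.prodMk hX).aemeasurable hf.aestronglyMeasurable]
    _ = ∫ y, ∫ m, f (y, m) ∂μ ∂(P.map fun ω => (b ω, h ω)) := by rw [hmap, integral_prod _ hint]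
    _ = ∫ y, cdf μ y.1 * y.2 ∂(P.map fun ω => (b ω, h ω)) := by
        refine integral_congr_ae (.of_forall fun y => ?_)
        have : (fun m => f (y, m)) = (Set.Iic y.1).indicator fun _ => y.2 := by
          funext m; simp [f, Set.indicator_apply]
        simp only [this]
        rw [integral_indicator_const _ measurableSet_Iic, cdf_eq_real, smul_eq_mul]
    _ = ∫ ω, cdf μ (b ω) * h ω ∂P := by
        have : Measurable fun y : ℝ × ℝ => cdf μ y.1 * y.2 :=
          ((monotone_cdf μ).measurable.comp measurable_fst).mul measurable_snd
        rw [integral_map hbh.aemeasurable this.aestronglyMeasurable]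

/-- Markov's inequality applied to `exp Y`. -/
theorem measureReal_le_exp_neg {Ω : Type*} [MeasurableSpace Ω] {P : Measure Ω}
    {Y : Ω → ℝ} (hY : Measurable Y)
    (h : ∫⁻ ω, ENNReal.ofReal (Real.exp (Y ω)) ∂P ≤ 1) (a : ℝ) :
    P.real {ω | a ≤ Y ω} ≤ Real.exp (-a) := by
  have hm := mul_meas_ge_le_lintegral (μ := P) (f := fun ω => ENNReal.ofReal (Real.exp (Y ω)))
    (by fun_prop) (ENNReal.ofReal (Real.exp a))
  have hset : {ω | ENNReal.ofReal (Real.exp a) ≤ ENNReal.ofReal (Real.exp (Y ω))} =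
      {ω | a ≤ Y ω} := by
    ext ω
    simp [ENNReal.ofReal_le_ofReal_iff (Real.exp_pos _).le]
  rw [hset] at hm
  have h1 := ENNReal.toReal_mono ENNReal.one_ne_top (hm.trans h)
  rw [ENNReal.toReal_mul, ENNReal.toReal_ofReal (Real.exp_pos a).le, ENNReal.toReal_one] at h1
  rw [Real.exp_neg, ← one_div, le_div_iff₀' (Real.exp_pos a)]
  exact h1

end Independence

/-! ### Measurability of the bids, win counts and deviations. -/

section Measurability

variable {F : ℝ → ℝ} (hF : Measurable (largestArgmax F)) (γ : ℝ)
include hF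

theorem measurable_ucbid1 (t : ℕ) :
    Measurable fun p : (ℕ → ℝ) × (ℕ → ℝ) => ucbid1 F γ p.1 p.2 t := by
  induction t using Nat.strong_induction_on with
  | _ t ih =>
  rcases Nat.eq_zero_or_pos t with rfl | ht
  · simp [ucbid1_zero]
  have hset : ∀ s ∈ Finset.range t,
      MeasurableSet {p : (ℕ → ℝ) × (ℕ → ℝ) | p.2 s ≤ ucbid1 F γ p.1 p.2 s} := fun s hs =>
    measurableSet_le (by fun_prop) (ih s (Finset.mem_range.1 hs))
  have hN : Measurable fun p : (ℕ → ℝ) × (ℕ → ℝ) => numObs p.2 (ucbid1 F γ p.1 p.2) t :=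
    Finset.measurable_sum _ fun s hs =>
      Measurable.ite (hset s hs) measurable_const measurable_const
  have hS : Measurable fun p : (ℕ → ℝ) × (ℕ → ℝ) =>
      ∑ s ∈ Finset.range t, if p.2 s ≤ ucbid1 F γ p.1 p.2 s then p.1 s else 0 :=
    Finset.measurable_sum _ fun s hs =>
      Measurable.ite (hset s hs) (by fun_prop) measurable_const
  simp only [fun p : (ℕ → ℝ) × (ℕ → ℝ) => ucbid1_of_pos F γ p.1 p.2 ht]
  refine hF.comp ?_
  unfold meanObs bonus
  fun_prop

theorem measurable_ucbidWins (t : ℕ) :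
    Measurable fun p : (ℕ → ℝ) × (ℕ → ℝ) => ucbidWins F γ p.1 p.2 t := by
  unfold ucbidWins numObs
  exact Finset.measurable_sum _ fun s _ =>
    Measurable.ite (measurableSet_le (by fun_prop) (measurable_ucbid1 hF γ s)) measurable_const
      measurable_const

theorem measurable_ucbidDeviation (v : ℝ) (t : ℕ) :
    Measurable fun p : (ℕ → ℝ) × (ℕ → ℝ) => ucbidDeviation F γ v p.1 p.2 t :=
  Finset.measurable_sum _ fun s _ =>
    Measurable.ite (measurableSet_le (by fun_prop) (measurable_ucbid1 hF γ s)) (by fun_prop)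
      measurable_const

end Measurability

/-- The stochastic model: independent values in `[0,1]` with mean `v` and opposing bids with
law `μ`. -/
structure IsAuctionModel {Ω : Type*} [MeasurableSpace Ω] (P : Measure Ω) (V M : ℕ → Ω → ℝ)
    (v : ℝ) (μ : Measure ℝ) : Prop where
  measurable_value : ∀ t, Measurable (V t)
  measurable_bid : ∀ t, Measurable (M t)
  indep : iIndepFun (Sum.elim V M) P
  value_mem : ∀ t, ∀ᵐ ω ∂P, V t ω ∈ Set.Icc (0 : ℝ) 1
  integral_value : ∀ t, ∫ ω, V t ω ∂P = v
  map_bid : ∀ t, P.map (M t) = μ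

/-! ### Self-normalized concentration of the observed values. -/

namespace IsAuctionModel

variable {Ω : Type*} [MeasurableSpace Ω] {P : Measure Ω} {V M : ℕ → Ω → ℝ} {v : ℝ}
  {μ : Measure ℝ} (A : IsAuctionModel P V M v μ)
include A

theorem measurable_sumElim (i : ℕ ⊕ ℕ) : Measurable (Sum.elim V M i) := by
  rcases i with t | t
  · exact A.measurable_value t
  · exact A.measurable_bid t

theorem measurable_path : Measurable fun ω => ((fun s => V s ω), fun s => M s ω) :=
  (measurable_pi_lambda _ A.measurable_value).prodMk (measurable_pi_lambda _ A.measurable_bid)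

/-- The value of round `t` is independent of earlier values and of opposing bids up to round `t`. -/
theorem indepFun_value {β : Type*} [MeasurableSpace β] (t : ℕ) {G : (ℕ → ℝ) × (ℕ → ℝ) → β}
    (hG : Measurable G)
    (hdep : ∀ p p', (∀ s < t, p.1 s = p'.1 s) → (∀ s ≤ t, p.2 s = p'.2 s) → G p = G p') :
    IndepFun (fun ω => G ((fun s => V s ω), fun s => M s ω)) (V t) P := by
  have hsplit : Measurable fun x : ℕ ⊕ ℕ → ℝ => ((fun s => x (.inl s)), fun s => x (.inr s)) := by
    fun_prop
  refine indepFun_of_dependsOn_finset (j := Sum.inl t) A.measurable_sumElim A.indep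
    ((Finset.range t).disjSum (Finset.range (t + 1))) (by simp) (hG.comp hsplit)
    fun x y h => hdep _ _ (fun s hs => h _ (by simpa using hs)) fun s hs => h _ (by simpa using hs)

/-- The opposing bid of round `t` is independent of the history before round `t`. -/
theorem indepFun_bid {β : Type*} [MeasurableSpace β] (t : ℕ) {G : (ℕ → ℝ) × (ℕ → ℝ) → β}
    (hG : Measurable G)
    (hdep : ∀ p p', (∀ s < t, p.1 s = p'.1 s) → (∀ s < t, p.2 s = p'.2 s) → G p = G p') :
    IndepFun (fun ω => G ((fun s => V s ω), fun s => M s ω)) (M t) P := by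
  have hsplit : Measurable fun x : ℕ ⊕ ℕ → ℝ => ((fun s => x (.inl s)), fun s => x (.inr s)) := by
    fun_prop
  refine indepFun_of_dependsOn_finset (j := Sum.inr t) A.measurable_sumElim A.indep
    ((Finset.range t).disjSum (Finset.range t)) (by simp) (hG.comp hsplit)
    fun x y h => hdep _ _ (fun s hs => h _ (by simpa using hs)) fun s hs => h _ (by simpa using hs)

variable [IsProbabilityMeasure P]

theorem mean_mem_Icc : v ∈ Set.Icc (0 : ℝ) 1 := by
  rw [← A.integral_value 0]
  refine ⟨integral_nonneg_of_ae ((A.value_mem 0).mono fun ω h => h.1), ?_⟩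
  have hint : Integrable (V 0) P :=
    Integrable.of_bound (A.measurable_value 0).aestronglyMeasurable 1
      ((A.value_mem 0).mono fun ω h => by rw [Real.norm_eq_abs, abs_of_nonneg h.1]; exact h.2)
  simpa using integral_mono_ae hint (integrable_const 1) ((A.value_mem 0).mono fun ω h => h.2)

theorem bid_le_one (hμ : μ (Set.Icc 0 1) = 1) (t : ℕ) : ∀ᵐ ω ∂P, M t ω ≤ 1 := by
  have hprob : IsProbabilityMeasure μ := by
    rw [← A.map_bid 0]; exact Measure.isProbabilityMeasure_map (A.measurable_bid 0).aemeasurable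
  have h : ∀ᵐ m ∂μ, m ∈ Set.Icc (0 : ℝ) 1 := (mem_ae_iff_prob_eq_one measurableSet_Icc).2 hμ
  rw [← A.map_bid t] at h
  exact (ae_of_ae_map (A.measurable_bid t).aemeasurable h).mono fun ω h => h.2

/-- Hoeffding's lemma on an interval of length one. -/
theorem lintegral_exp_value_le_one (l : ℝ) (t : ℕ) :
    ∫⁻ ω, ENNReal.ofReal (Real.exp (l * (V t ω - v) - l ^ 2 / 8)) ∂P ≤ 1 := by
  have hsub := hasSubgaussianMGF_of_mem_Icc (A.measurable_value t).aemeasurable (A.value_mem t)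
  rw [A.integral_value t] at hsub
  have hle := hsub.mgf_le l
  have hint := hsub.integrable_exp_mul l
  have heq : ∀ ω, Real.exp (l * (V t ω - v) - l ^ 2 / 8) =
      Real.exp (l * (V t ω - v)) * Real.exp (-(l ^ 2 / 8)) := fun ω => by
    rw [← Real.exp_add, sub_eq_add_neg]
  simp only [heq]
  rw [← ofReal_integral_eq_lintegral_ofReal (hint.mul_const _)
    (.of_forall fun ω => by positivity), integral_mul_const, ENNReal.ofReal_le_one]
  refine (mul_le_mul_of_nonneg_right hle (Real.exp_pos _).le).trans ?_
  rw [← Real.exp_add, Real.exp_le_one_iff]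
  norm_num
  linarith

variable {F : ℝ → ℝ} (hF : Measurable (largestArgmax F)) (γ : ℝ)
include hF

/-- Exponential supermartingale bound for the observed centred values. -/
theorem lintegral_exp_deviation_le_one (l : ℝ) (t : ℕ) :
    ∫⁻ ω, ENNReal.ofReal (Real.exp
      (l * ucbidDeviation F γ v (fun s => V s ω) (fun s => M s ω) t
        - l ^ 2 / 8 * ucbidWins F γ (fun s => V s ω) (fun s => M s ω) t)) ∂P ≤ 1 := by
  induction t with
  | zero => simp [ucbidDeviation, ucbidWins, numObs]
  | succ t ih =>
    let E : (ℕ → ℝ) × (ℕ → ℝ) → ENNReal := fun p => ENNReal.ofReal (Real.exp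
      (l * ucbidDeviation F γ v p.1 p.2 t - l ^ 2 / 8 * ucbidWins F γ p.1 p.2 t))
    let W : Set ((ℕ → ℝ) × (ℕ → ℝ)) := {p | p.2 t ≤ ucbid1 F γ p.1 p.2 t}
    have hE : Measurable E := by
      have h1 := measurable_ucbidDeviation hF γ v t
      have h2 := measurable_ucbidWins hF γ t
      fun_prop
    have hW : MeasurableSet W := measurableSet_le (by fun_prop) (measurable_ucbid1 hF γ t)
    let path : Ω → (ℕ → ℝ) × (ℕ → ℝ) := fun ω => ((fun s => V s ω), fun s => M s ω)
    have hpath : Measurable path := A.measurable_path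
    let ξ : Ω → ENNReal := fun ω => ENNReal.ofReal (Real.exp (l * (V t ω - v) - l ^ 2 / 8))
    have hξ : Measurable ξ := by
      have := A.measurable_value t
      fun_prop
    -- Winning round `t` is decided by the past and `M t`, so the value `V t` is still fresh when it
    -- is observed.
    have hind : IndepFun (fun ω => W.indicator E (path ω)) ξ P := by
      have h := A.indepFun_value t (G := W.indicator E) (hE.indicator hW) (by
        intro p p' hV hM
        have hM' : ∀ s < t, p.2 s = p'.2 s := fun s hs => hM s hs.le
        have hmem : p ∈ W ↔ p' ∈ W := by
          change p.2 t ≤ _ ↔ p'.2 t ≤ _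
          rw [hM t le_rfl, ucbid1_congr F γ hV hM']
        have hEq : E p = E p' := by
          simp only [E]
          rw [ucbidDeviation_congr F γ v hV hM', ucbidWins_congr F γ hV hM']
        by_cases hp : p ∈ W
        · rw [Set.indicator_of_mem hp, Set.indicator_of_mem (hmem.1 hp), hEq]
        · rw [Set.indicator_of_notMem hp, Set.indicator_of_notMem (fun h => hp (hmem.2 h))])
      exact h.comp measurable_id
        (show Measurable fun x : ℝ => ENNReal.ofReal (Real.exp (l * (x - v) - l ^ 2 / 8)) by
          fun_prop)
    have hstep : ∀ ω, ENNReal.ofReal (Real.exp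
        (l * ucbidDeviation F γ v (fun s => V s ω) (fun s => M s ω) (t + 1)
          - l ^ 2 / 8 * ucbidWins F γ (fun s => V s ω) (fun s => M s ω) (t + 1))) =
        W.indicator E (path ω) * ξ ω + Wᶜ.indicator E (path ω) := by
      intro ω
      rw [ucbidDeviation_succ, ucbidWins_succ]
      by_cases h : path ω ∈ W
      · rw [Set.indicator_of_mem h, Set.indicator_of_notMem (by simpa using h), add_zero]
        simp only [E, ξ]
        rw [← ENNReal.ofReal_mul (Real.exp_pos _).le, ← Real.exp_add]
        have h' : M t ω ≤ ucbid1 F γ (fun s => V s ω) (fun s => M s ω) t := h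
        simp only [if_pos h']
        congr 2
        simp only [path]
        ring
      · rw [Set.indicator_of_notMem h, Set.indicator_of_mem (by simpa using h), zero_mul, zero_add]
        have h' : ¬ M t ω ≤ ucbid1 F γ (fun s => V s ω) (fun s => M s ω) t := h
        simp only [if_neg h', add_zero, E, path]
    simp only [hstep]
    have hm1 : Measurable fun ω => W.indicator E (path ω) := (hE.indicator hW).comp hpath
    rw [lintegral_add_left (show Measurable fun ω => W.indicator E (path ω) * ξ ω from hm1.mul hξ)]
    have hprod := lintegral_mul_eq_lintegral_mul_lintegral_of_indepFun hm1 hξ hind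
    simp only [Pi.mul_apply] at hprod
    rw [hprod]
    calc _ ≤ (∫⁻ ω, W.indicator E (path ω) ∂P) * 1 + ∫⁻ ω, Wᶜ.indicator E (path ω) ∂P := by
          gcongr
          exact A.lintegral_exp_value_le_one l t
      _ = ∫⁻ ω, E (path ω) ∂P := by
          rw [mul_one, ← lintegral_add_left hm1]
          refine lintegral_congr fun ω => ?_
          exact Set.indicator_self_add_compl_apply W E (path ω)
      _ ≤ 1 := ih

/-- Self-normalized deviation inequality, by peeling over a geometric grid of the number of
observations. The sign `σ` selects the upper or the lower deviation. -/
theorem measureReal_deviation_le (hγ : 0 ≤ γ) {σ s : ℝ} (hσ : σ ^ 2 = 1) (hs : 0 < s)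
    {t : ℕ} (ht : 0 < t) :
    P.real {ω | 1 ≤ ucbidWins F γ (fun s => V s ω) (fun s => M s ω) t ∧
        √(γ * Real.log t / 2) * √(ucbidWins F γ (fun s => V s ω) (fun s => M s ω) t) <
          σ * ucbidDeviation F γ v (fun s => V s ω) (fun s => M s ω) t} ≤
      (Real.log t / Real.log (1 + s) + 1) * (t : ℝ) ^ (-(γ * (1 - s ^ 2))) := by
  set N : Ω → ℝ := fun ω => ucbidWins F γ (fun s => V s ω) (fun s => M s ω) t
  set Z : Ω → ℝ := fun ω => ucbidDeviation F γ v (fun s => V s ω) (fun s => M s ω) t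
  have hN : Measurable N := (measurable_ucbidWins hF γ t).comp A.measurable_path
  have hZ : Measurable Z := (measurable_ucbidDeviation hF γ v t).comp A.measurable_path
  have ht1 : (1 : ℝ) ≤ t := by exact_mod_cast ht
  have hL : 0 ≤ Real.log t := Real.log_nonneg ht1
  have hq : 0 < Real.log (1 + s) := Real.log_pos (by linarith)
  set r := √(γ * Real.log t / 2) with hr
  have hr0 : 0 ≤ r := Real.sqrt_nonneg _
  have hr2 : r ^ 2 = γ * Real.log t / 2 := Real.sq_sqrt (by positivity)
  set a := γ * (1 - s ^ 2) * Real.log t with ha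
  -- The maximizer of `l * r * √N - l ^ 2 / 8 * N` when `√N = (1 + s) ^ k`.
  let lam : ℕ → ℝ := fun k => 4 * r / (1 + s) ^ k
  let K := ⌊Real.log t / Real.log (1 + s)⌋₊
  have hsub : {ω | 1 ≤ N ω ∧ r * √(N ω) < σ * Z ω} ⊆
      ⋃ k ∈ Finset.range (K + 1),
        {ω | a ≤ (σ * lam k) * Z ω - (σ * lam k) ^ 2 / 8 * N ω} := by
    rintro ω ⟨h1, hdev⟩
    have hsN : 1 ≤ √(N ω) := Real.one_le_sqrt.2 h1
    obtain ⟨k, hk1, hk2⟩ := exists_nat_pow_near hsN (show 1 < 1 + s by linarith)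
    have hpk : 0 < (1 + s) ^ k := by positivity
    have hkK : k ≤ K := by
      -- The crude bound `√N ≤ √t ≤ t` limits the number of grid cells.
      refine Nat.le_floor ?_
      rw [le_div_iff₀ hq, ← Real.log_pow]
      refine Real.log_le_log hpk (hk1.trans ?_)
      refine (Real.sqrt_le_sqrt (ucbidWins_le F γ _ _ t)).trans ?_
      exact Real.sqrt_le_iff.2 ⟨by linarith, by nlinarith⟩
    simp only [Set.mem_iUnion, Finset.mem_range]
    refine ⟨k, by omega, ?_⟩
    simp only [Set.mem_ofPred_eq, mul_pow, hσ, one_mul]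
    set ρ := √(N ω) / (1 + s) ^ k with hρ
    have hρN : √(N ω) = ρ * (1 + s) ^ k := by rw [hρ]; field_simp
    have hρ1 : 1 ≤ ρ := (one_le_div hpk).2 hk1
    have hρ2 : ρ ≤ 1 + s := by
      rw [hρ, div_le_iff₀ hpk, ← pow_succ']; exact hk2.le
    have hN2 : N ω = ρ ^ 2 * ((1 + s) ^ k) ^ 2 := by
      rw [← mul_pow, ← hρN, Real.sq_sqrt (by linarith)]
    have hlam : lam k * (1 + s) ^ k = 4 * r := by simp only [lam]; field_simp
    have hlam0 : 0 ≤ lam k := by positivity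
    have h2 : lam k * (r * √(N ω)) ≤ lam k * (σ * Z ω) :=
      mul_le_mul_of_nonneg_left hdev.le hlam0
    have h3 : lam k * (r * √(N ω)) = 4 * r ^ 2 * ρ := by
      rw [hρN]; linear_combination (r * ρ) * hlam
    have h4 : lam k ^ 2 / 8 * N ω = 2 * r ^ 2 * ρ ^ 2 := by
      rw [hN2]
      linear_combination (ρ ^ 2 / 8) * (lam k * (1 + s) ^ k + 4 * r) * hlam
    rw [h4]
    have h5 : a = 2 * r ^ 2 * (1 - s ^ 2) := by rw [hr2, ha]; ring
    -- The exponent exceeds `4r²ρ - 2r²ρ² = 2r²(1 - (ρ - 1)²)`, so misplacing `√N` by a factor `ρ ≤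
    -- 1 + s` costs at most the factor `1 - s²`.
    have h6 : 0 ≤ r ^ 2 * (s ^ 2 - (ρ - 1) ^ 2) :=
      mul_nonneg (sq_nonneg r) (by nlinarith)
    rw [h5]
    nlinarith
  have hexp : Real.exp (-a) = (t : ℝ) ^ (-(γ * (1 - s ^ 2))) := by
    rw [Real.rpow_def_of_pos (by linarith), ha]; congr 1; ring
  calc _ ≤ P.real (⋃ k ∈ Finset.range (K + 1),
        {ω | a ≤ (σ * lam k) * Z ω - (σ * lam k) ^ 2 / 8 * N ω}) := 
          measureReal_mono hsub (measure_ne_top _ _)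
    _ ≤ ∑ k ∈ Finset.range (K + 1),
        P.real {ω | a ≤ (σ * lam k) * Z ω - (σ * lam k) ^ 2 / 8 * N ω} :=
        measureReal_biUnion_finset_le _ _
    _ ≤ ∑ _k ∈ Finset.range (K + 1), Real.exp (-a) :=
        Finset.sum_le_sum fun k _ => measureReal_le_exp_neg
          ((hZ.const_mul _).sub (hN.const_mul _))
          (A.lintegral_exp_deviation_le_one hF γ (σ * lam k) t) a
    _ = ((K : ℝ) + 1) * Real.exp (-a) := by simp
    _ ≤ _ := by
        rw [hexp]
        gcongr
        exact Nat.floor_le (by positivity)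

end IsAuctionModel

/-- The logarithm is dominated by a multiple of `t ^ ((p - 1) / 2)`, leaving an exponent still below
`-1`. -/
theorem summable_log_mul_rpow {p : ℝ} (hp : 1 < p) (c : ℝ) :
    Summable fun t : ℕ => (Real.log t / c + 1) * (t : ℝ) ^ (-p) := by
  have h1 : Summable fun t : ℕ => (t : ℝ) ^ (-p) := Real.summable_nat_rpow.2 (by linarith)
  have h2 : Summable fun t : ℕ => Real.log t * (t : ℝ) ^ (-p) := by
    have hε : 0 < (p - 1) / 2 := by linarith
    refine Summable.of_nonneg_of_le (fun t => mul_nonneg (Real.log_natCast_nonneg t)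
      (Real.rpow_nonneg t.cast_nonneg _)) (fun t => ?_)
      ((Real.summable_nat_rpow (p := (p - 1) / 2 + -p).2 (by linarith)).div_const ((p - 1) / 2))
    rcases Nat.eq_zero_or_pos t with rfl | ht
    · simp only [Nat.cast_zero, Real.log_zero, zero_mul]
      exact div_nonneg (Real.rpow_nonneg le_rfl _) hε.le
    · rw [Real.rpow_add (by exact_mod_cast ht), mul_div_right_comm]
      exact mul_le_mul_of_nonneg_right (Real.log_le_rpow_div t.cast_nonneg hε)
        (Real.rpow_nonneg t.cast_nonneg _)
  refine ((h2.div_const c).add h1).congr fun t => ?_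
  ring

/-- Instantaneous regret of UCBid1 when the empirical mean lies within the confidence radius. -/
theorem utility_sub_utility_ucbid1_le (F : StieltjesFunction ℝ) (hF0 : ∀ x, 0 ≤ F x)
    (hF1 : ∀ x, F x ≤ 1) {γ v bstar : ℝ} (hγ : 0 ≤ γ) (hv : v ∈ Set.Icc (0 : ℝ) 1)
    (hb : IsGreatest (argmaxBids F v) bstar) (hF : 0 < F bstar) (V M : ℕ → ℝ) {t : ℕ}
    (ht : 0 < t) (hN : 1 ≤ ucbidWins F γ V M t)
    (hdev : |ucbidDeviation F γ v V M t| ≤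
      √(γ * Real.log t / 2) * √(ucbidWins F γ V M t)) :
    utility F v bstar - utility F v (ucbid1 F γ V M t) ≤
      (1 - F bstar) * √(2 * γ * Real.log t) *
        (F (ucbid1 F γ V M t) * (√(ucbidWins F γ V M t))⁻¹) := by
  have hmean := meanObs_sub F γ v V M (t := t) (by linarith)
  set N := ucbidWins F γ V M t with hNdef
  set r := √(γ * Real.log t / 2) with hr
  have hL : 0 ≤ Real.log t := Real.log_natCast_nonneg t
  have hsN : 1 ≤ √N := Real.one_le_sqrt.2 hN
  have hbonus : bonus γ M (ucbid1 F γ V M) t = r * (√N)⁻¹ := by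
    rw [bonus, hr, ← div_eq_mul_inv, ← Real.sqrt_div (by positivity), div_div]
    rfl
  have h2r : √(2 * γ * Real.log t) = 2 * r := by
    rw [hr, show 2 * γ * Real.log t = 2 ^ 2 * (γ * Real.log t / 2) by ring,
      Real.sqrt_mul (by norm_num), Real.sqrt_sq (by norm_num)]
  have hdevN : |ucbidDeviation F γ v V M t / N| ≤ r * (√N)⁻¹ := by
    rw [abs_div, abs_of_pos (show 0 < N by linarith), div_le_iff₀ (by linarith)]
    refine hdev.trans_eq ?_
    nth_rewrite 3 [← Real.mul_self_sqrt (show 0 ≤ N by linarith)]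
    field_simp
  obtain ⟨h1, h2⟩ := abs_le.1 hdevN
  rw [← hmean] at h1 h2
  have hw1 : v ≤ meanObs V M (ucbid1 F γ V M) t + bonus γ M (ucbid1 F γ V M) t := by linarith
  obtain ⟨hle, hreg⟩ := largestArgmax_spec F hF0 hv hb hF hw1
  rw [← ucbid1_of_pos F γ V M ht] at hle hreg
  set B := ucbid1 F γ V M t
  have h3 : F bstar ≤ F B := F.mono hle
  -- Equivalent to `F bstar * F B ≤ F bstar`. The factor `F B` is kept as the winning probability.
  have h4 : F B - F bstar ≤ (1 - F bstar) * F B := by nlinarith [hF1 B]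
  calc _ ≤ _ := hreg
    _ ≤ (2 * (r * (√N)⁻¹)) * ((1 - F bstar) * F B) := by
        refine mul_le_mul (by linarith) h4 (by linarith) ?_
        positivity
    _ = _ := by rw [h2r]; ring

/-! ### Expected regret, per round and summed. -/

namespace IsAuctionModel

variable {Ω : Type*} [MeasurableSpace Ω] {P : Measure Ω} [IsProbabilityMeasure P]
  {V M : ℕ → Ω → ℝ} {v : ℝ} {μ : Measure ℝ}

/-- The winning probability in round `t` given the history is `F` of the bid. -/
theorem integral_cdf_mul_inv_sqrt [IsProbabilityMeasure μ]
    (A : IsAuctionModel P V M v μ) (γ : ℝ) (t : ℕ) :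
    ∫ ω, cdf μ (ucbid1 (cdf μ) γ (fun s => V s ω) (fun s => M s ω) t) *
        (√(ucbidWins (cdf μ) γ (fun s => V s ω) (fun s => M s ω) t))⁻¹ ∂P =
      ∫ ω, (if M t ω ≤ ucbid1 (cdf μ) γ (fun s => V s ω) (fun s => M s ω) t then
        (√(ucbidWins (cdf μ) γ (fun s => V s ω) (fun s => M s ω) t))⁻¹ else 0) ∂P := by
  have hm : Measurable (largestArgmax (cdf μ)) :=
    (monotone_largestArgmax (cdf μ) (cdf_nonneg μ)).measurable
  have hB := measurable_ucbid1 hm γ t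
  have hN : Measurable fun p : (ℕ → ℝ) × (ℕ → ℝ) => (√(ucbidWins (cdf μ) γ p.1 p.2 t))⁻¹ :=
    (measurable_ucbidWins hm γ t).sqrt.inv
  refine (integral_ite_le_eq_integral_mul_cdf (hB.comp A.measurable_path)
    (hN.comp A.measurable_path) (A.measurable_bid t) (fun ω => ?_) ?_ (A.map_bid t)).symm
  -- Integrality of the win count bounds the weight by one everywhere, the zero count included
  -- because `0⁻¹ = 0`.
  · obtain ⟨n, hn⟩ : ∃ n : ℕ, ucbidWins (cdf μ) γ (fun s => V s ω) (fun s => M s ω) t = n := by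
      unfold ucbidWins numObs
      exact ⟨_, Finset.sum_boole _ _⟩
    simp only [Function.comp, hn]
    rw [abs_of_nonneg (by positivity)]
    rcases Nat.eq_zero_or_pos n with rfl | h
    · simp
    · exact inv_le_one_of_one_le₀ (Real.one_le_sqrt.2 (by exact_mod_cast h))
  · exact A.indepFun_bid t (hB.prodMk hN) fun p p' hV hM => by
      rw [ucbid1_congr (cdf μ) γ hV hM, ucbidWins_congr (cdf μ) γ hV hM]

/-- Expected regret of a single round. -/
theorem utility_sub_integral_utility_le [IsProbabilityMeasure μ]
    (A : IsAuctionModel P V M v μ) (hμ : μ (Set.Icc 0 1) = 1)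
    {γ bstar s : ℝ} (hγ : 0 ≤ γ) (hs : 0 < s) (hb : IsGreatest (argmaxBids (cdf μ) v) bstar)
    (hF : 0 < cdf μ bstar) {t : ℕ} (ht : 0 < t) :
    utility (cdf μ) v bstar -
        ∫ ω, utility (cdf μ) v (ucbid1 (cdf μ) γ (fun s => V s ω) (fun s => M s ω) t) ∂P ≤
      (1 - cdf μ bstar) * √(2 * γ * Real.log t) *
        ∫ ω, (if M t ω ≤ ucbid1 (cdf μ) γ (fun s => V s ω) (fun s => M s ω) t then
          (√(ucbidWins (cdf μ) γ (fun s => V s ω) (fun s => M s ω) t))⁻¹ else 0) ∂P +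
      4 * ((Real.log t / Real.log (1 + s) + 1) * (t : ℝ) ^ (-(γ * (1 - s ^ 2)))) := by
  have hm : Measurable (largestArgmax (cdf μ)) :=
    (monotone_largestArgmax (cdf μ) (cdf_nonneg μ)).measurable
  have hv := A.mean_mem_Icc
  rw [← A.integral_cdf_mul_inv_sqrt γ t]
  set B : Ω → ℝ := fun ω => ucbid1 (cdf μ) γ (fun s => V s ω) (fun s => M s ω) t with hBdef
  set N : Ω → ℝ := fun ω => ucbidWins (cdf μ) γ (fun s => V s ω) (fun s => M s ω) t with hNdef
  set Z : Ω → ℝ := fun ω => ucbidDeviation (cdf μ) γ v (fun s => V s ω) (fun s => M s ω) t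
    with hZdef
  have hBm : Measurable B := (measurable_ucbid1 hm γ t).comp A.measurable_path
  have hNm : Measurable N := (measurable_ucbidWins hm γ t).comp A.measurable_path
  have hZm : Measurable Z := (measurable_ucbidDeviation hm γ v t).comp A.measurable_path
  have hFm : Measurable (cdf μ) := (monotone_cdf μ).measurable
  have hB01 : ∀ ω, B ω ∈ Set.Icc (0 : ℝ) 1 := fun ω => ucbid1_mem_Icc _ _ _ _ _
  have hUm : Measurable fun ω => utility (cdf μ) v (B ω) := by
    unfold utility
    exact (measurable_const.sub hBm).mul (hFm.comp hBm)
  have hUb : ∀ b ∈ Set.Icc (0 : ℝ) 1, |utility (cdf μ) v b| ≤ 1 := fun b hb =>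
    abs_utility_le_one (cdf_nonneg μ) (cdf_le_one μ) hv hb
  have hUint : Integrable (fun ω => utility (cdf μ) v (B ω)) P :=
    Integrable.of_bound hUm.aestronglyMeasurable 1 (.of_forall fun ω => hUb _ (hB01 ω))
  set r := √(γ * Real.log t / 2) with hr
  -- The upper and lower failures are `σ = 1` and `σ = -1`. Each is charged the maximal loss `2`,
  -- whence the factor `4`.
  let bad : ℝ → Set Ω := fun σ => {ω | 1 ≤ N ω ∧ r * √(N ω) < σ * Z ω}
  have hbadm : ∀ σ, MeasurableSet (bad σ) := fun σ =>
    (measurableSet_le measurable_const hNm).inter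
      (measurableSet_lt (hNm.sqrt.const_mul _) (hZm.const_mul _))
  have hbad : ∀ σ : ℝ, σ ^ 2 = 1 → P.real (bad σ) ≤
      (Real.log t / Real.log (1 + s) + 1) * (t : ℝ) ^ (-(γ * (1 - s ^ 2))) := fun σ hσ =>
    A.measureReal_deviation_le hm γ hγ hσ hs ht
  have hN1 : ∀ᵐ ω ∂P, 1 ≤ N ω := (A.bid_le_one hμ 0).mono fun ω h =>
    one_le_ucbidWins _ _ _ _ h ht
  have hwint : Integrable (fun ω => cdf μ (B ω) * (√(N ω))⁻¹) P := by
    refine Integrable.of_bound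
      ((hFm.comp hBm).mul hNm.sqrt.inv).aestronglyMeasurable 1 (hN1.mono fun ω h => ?_)
    have h0 := cdf_nonneg μ (B ω)
    rw [Real.norm_eq_abs, abs_of_nonneg (by positivity)]
    exact mul_le_one₀ (cdf_le_one μ _) (by positivity)
      (inv_le_one_of_one_le₀ (Real.one_le_sqrt.2 h))
  set c := (1 - cdf μ bstar) * √(2 * γ * Real.log t) with hc
  have hc0 : 0 ≤ c := mul_nonneg (sub_nonneg.2 (cdf_le_one μ _)) (Real.sqrt_nonneg _)
  have hind : ∀ σ, Integrable ((bad σ).indicator fun _ => (2 : ℝ)) P := fun σ =>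
    (integrable_const 2).indicator (hbadm σ)
  have hpt : ∀ᵐ ω ∂P, utility (cdf μ) v bstar - utility (cdf μ) v (B ω) ≤
      c * (cdf μ (B ω) * (√(N ω))⁻¹) +
        ((bad 1).indicator (fun _ => (2 : ℝ)) ω + (bad (-1)).indicator (fun _ => (2 : ℝ)) ω) := by
    filter_upwards [hN1] with ω h1
    have hi : ∀ σ, 0 ≤ (bad σ).indicator (fun _ => (2 : ℝ)) ω := fun σ =>
      Set.indicator_nonneg (fun _ _ => zero_le_two) ω
    have h0 := cdf_nonneg μ (B ω)
    have hmain0 : 0 ≤ c * (cdf μ (B ω) * (√(N ω))⁻¹) := by positivity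
    have hle2 : utility (cdf μ) v bstar - utility (cdf μ) v (B ω) ≤ 2 := by
      have h3 := (abs_le.1 (hUb _ hb.1.1)).2
      have h4 := (abs_le.1 (hUb _ (hB01 ω))).1
      linarith
    by_cases hp : ω ∈ bad 1
    · rw [Set.indicator_of_mem hp]
      linarith [hi (-1)]
    by_cases hn : ω ∈ bad (-1)
    · rw [Set.indicator_of_mem hn]
      linarith [hi 1]
    have hp' : Z ω ≤ r * √(N ω) := by
      by_contra! h
      exact hp ⟨h1, by linarith⟩
    have hn' : -(r * √(N ω)) ≤ Z ω := by
      by_contra! h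
      exact hn ⟨h1, by linarith⟩
    have := utility_sub_utility_ucbid1_le (cdf μ) (cdf_nonneg μ) (cdf_le_one μ) hγ hv hb hF
      (fun s => V s ω) (fun s => M s ω) ht h1 (abs_le.2 ⟨hn', hp'⟩)
    linarith [hi 1, hi (-1)]
  have hI := integral_mono_ae ((integrable_const _).sub hUint)
    ((hwint.const_mul c).add ((hind 1).add (hind (-1)))) hpt
  have hleft : ∫ ω, (utility (cdf μ) v bstar - utility (cdf μ) v (B ω)) ∂P =
      utility (cdf μ) v bstar - ∫ ω, utility (cdf μ) v (B ω) ∂P := by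
    rw [integral_sub (integrable_const _) hUint]; simp
  have hright : ∫ ω, (c * (cdf μ (B ω) * (√(N ω))⁻¹) +
        ((bad 1).indicator (fun _ => (2 : ℝ)) ω + (bad (-1)).indicator (fun _ => (2 : ℝ)) ω)) ∂P =
      c * ∫ ω, cdf μ (B ω) * (√(N ω))⁻¹ ∂P + (P.real (bad 1) * 2 + P.real (bad (-1)) * 2) := by
    have hsum : Integrable (fun ω => (bad 1).indicator (fun _ => (2 : ℝ)) ω +
        (bad (-1)).indicator (fun _ => (2 : ℝ)) ω) P := (hind 1).add (hind (-1))
    rw [integral_add (hwint.const_mul c) hsum, integral_add (hind 1) (hind (-1)),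
      integral_indicator_const _ (hbadm 1), integral_indicator_const _ (hbadm (-1)),
      integral_const_mul, smul_eq_mul, smul_eq_mul]
  have hI' := hleft.symm.trans_le (hI.trans_eq hright)
  have hp := hbad 1 (by norm_num)
  have hn := hbad (-1) (by norm_num)
  linarith

/-- The expected inverse square roots of the number of observations, summed over won auctions. -/
theorem sum_integral_inv_sqrt_le (A : IsAuctionModel P V M v μ) (hμ : μ (Set.Icc 0 1) = 1)
    (γ : ℝ) (T : ℕ) :
    ∑ t ∈ Finset.range T,
      ∫ ω, (if M t ω ≤ ucbid1 (cdf μ) γ (fun s => V s ω) (fun s => M s ω) t then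
        (√(ucbidWins (cdf μ) γ (fun s => V s ω) (fun s => M s ω) t))⁻¹ else 0) ∂P ≤ 4 * √T := by
  have hm : Measurable (largestArgmax (cdf μ)) :=
    (monotone_largestArgmax (cdf μ) (cdf_nonneg μ)).measurable
  have hint : ∀ t ∈ Finset.range T, Integrable (fun ω =>
      if M t ω ≤ ucbid1 (cdf μ) γ (fun s => V s ω) (fun s => M s ω) t then
        (√(ucbidWins (cdf μ) γ (fun s => V s ω) (fun s => M s ω) t))⁻¹ else 0) P := by
    intro t _
    have hmeas : Measurable fun ω =>
        if M t ω ≤ ucbid1 (cdf μ) γ (fun s => V s ω) (fun s => M s ω) t then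
          (√(ucbidWins (cdf μ) γ (fun s => V s ω) (fun s => M s ω) t))⁻¹ else 0 :=
      Measurable.ite
        (measurableSet_le (A.measurable_bid t) ((measurable_ucbid1 hm γ t).comp A.measurable_path))
        ((measurable_ucbidWins hm γ t).comp A.measurable_path).sqrt.inv measurable_const
    refine Integrable.of_bound hmeas.aestronglyMeasurable 1 ?_
    filter_upwards [A.bid_le_one hμ 0] with ω h
    rw [Real.norm_eq_abs]
    split_ifs
    · rw [abs_of_nonneg (by positivity)]
      rcases Nat.eq_zero_or_pos t with rfl | ht
      · simp [ucbidWins, numObs]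
      · exact inv_le_one_of_one_le₀ (Real.one_le_sqrt.2 (one_le_ucbidWins _ _ _ _ h ht))
    · simp
  rw [← integral_finsetSum _ hint]
  refine (integral_mono_ae (integrable_finsetSum _ hint) (integrable_const (4 * √(T : ℝ))) ?_).trans
    (by simp)
  filter_upwards [A.bid_le_one hμ 0] with ω h
  refine (sum_inv_sqrt_ucbidWins_le (cdf μ) γ (fun s => V s ω) (fun s => M s ω) h T).trans ?_
  gcongr
  exact ucbidWins_le _ _ _ _ _

/-- Regret bound for UCBid1 with an explicit remainder. -/
theorem regret_ucbid1_le [IsProbabilityMeasure μ]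
    (A : IsAuctionModel P V M v μ) (hμ : μ (Set.Icc 0 1) = 1)
    {γ bstar s : ℝ} (hγ : 0 ≤ γ) (hs : 0 < s) (hs1 : 1 < γ * (1 - s ^ 2))
    (hb : IsGreatest (argmaxBids (cdf μ) v) bstar)
    (hF : 0 < cdf μ bstar) (T : ℕ) :
    regret P (cdf μ) v
        (fun t ω => ucbid1 (cdf μ) γ (fun s => V s ω) (fun s => M s ω) t) T ≤
      √(2 * γ) / cdf μ bstar * √(T * Real.log T) +
        (2 + 4 * ∑' t : ℕ, (Real.log t / Real.log (1 + s) + 1) *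
          (t : ℝ) ^ (-(γ * (1 - s ^ 2)))) := by
  have hv := A.mean_mem_Icc
  set f := cdf μ bstar with hf
  have hf1 : f ≤ 1 := cdf_le_one μ _
  let d : ℕ → ℝ := fun t =>
    (Real.log t / Real.log (1 + s) + 1) * (t : ℝ) ^ (-(γ * (1 - s ^ 2)))
  have hd : Summable d := summable_log_mul_rpow hs1 _
  have hq : 0 < Real.log (1 + s) := Real.log_pos (by linarith)
  have hd0 : ∀ t, 0 ≤ d t := fun t => by
    have := Real.log_natCast_nonneg t
    positivity
  let J : ℕ → ℝ := fun t =>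
    ∫ ω, (if M t ω ≤ ucbid1 (cdf μ) γ (fun s => V s ω) (fun s => M s ω) t then
      (√(ucbidWins (cdf μ) γ (fun s => V s ω) (fun s => M s ω) t))⁻¹ else 0) ∂P
  have hJ0 : ∀ t, 0 ≤ J t := fun t => integral_nonneg fun ω => by
    dsimp only
    split_ifs <;> positivity
  let c := (1 - f) * √(2 * γ * Real.log T)
  have hc0 : 0 ≤ c := mul_nonneg (by linarith) (Real.sqrt_nonneg _)
  have hround : ∀ t ∈ Finset.range T, utility (cdf μ) v bstar -
      ∫ ω, utility (cdf μ) v (ucbid1 (cdf μ) γ (fun s => V s ω) (fun s => M s ω) t) ∂P ≤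
      c * J t + 4 * d t + if t = 0 then 2 else 0 := by
    intro t htT
    rcases Nat.eq_zero_or_pos t with rfl | ht
    · simp only [ucbid1_zero, integral_const, probReal_univ, one_smul, if_true]
      have hU : ∀ b ∈ Set.Icc (0 : ℝ) 1, |utility (cdf μ) v b| ≤ 1 := fun b hb =>
        abs_utility_le_one (cdf_nonneg μ) (cdf_le_one μ) hv hb
      have h1 := (abs_le.1 (hU _ hb.1.1)).2
      have h2 := (abs_le.1 (hU 1 (by simp))).1
      linarith [mul_nonneg hc0 (hJ0 0), hd0 0]
    · rw [if_neg ht.ne', add_zero]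
      refine (A.utility_sub_integral_utility_le hμ hγ hs hb hF ht).trans ?_
      refine add_le_add_left (mul_le_mul_of_nonneg_right ?_ (hJ0 t)) _
      refine mul_le_mul_of_nonneg_left (Real.sqrt_le_sqrt ?_) (by linarith)
      have : Real.log t ≤ Real.log T := Real.log_le_log (by exact_mod_cast ht)
        (by exact_mod_cast (Finset.mem_range.1 htT).le)
      exact mul_le_mul_of_nonneg_left this (by positivity)
  have hJsum : ∑ t ∈ Finset.range T, J t ≤ 4 * √T := A.sum_integral_inv_sqrt_le hμ γ T
  have hdsum : ∑ t ∈ Finset.range T, d t ≤ ∑' t, d t := hd.sum_le_tsum _ fun t _ => hd0 t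
  have hfirst : ∑ t ∈ Finset.range T, (if t = 0 then (2 : ℝ) else 0) ≤ 2 := by
    rw [Finset.sum_ite_eq']
    split_ifs <;> norm_num
  have hmain : c * (4 * √T) ≤ √(2 * γ) / f * √(T * Real.log T) := by
    have hL : 0 ≤ Real.log T := Real.log_natCast_nonneg T
    have h1 : √(2 * γ * Real.log T) = √(2 * γ) * √(Real.log T) := Real.sqrt_mul (by positivity) _
    have h2 : √(T * Real.log T) = √T * √(Real.log T) := Real.sqrt_mul (by positivity) _
    -- This is `(2f - 1)² ≥ 0`, with equality at `f = 1/2`.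
    have h3 : 4 * (1 - f) ≤ 1 / f := by
      rw [le_div_iff₀ hF]
      nlinarith [sq_nonneg (2 * f - 1)]
    calc c * (4 * √T) = 4 * (1 - f) * (√(2 * γ) * (√T * √(Real.log T))) := by
          simp only [c]; rw [h1]; ring
      _ ≤ 1 / f * (√(2 * γ) * (√T * √(Real.log T))) :=
          mul_le_mul_of_nonneg_right h3 (by positivity)
      _ = _ := by rw [h2]; ring
  calc regret P (cdf μ) v _ T
      = ∑ t ∈ Finset.range T, (utility (cdf μ) v bstar -
          ∫ ω, utility (cdf μ) v (ucbid1 (cdf μ) γ (fun s => V s ω) (fun s => M s ω) t) ∂P) := by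
        rw [regret, iSup_utility_eq hb.1, Finset.sum_sub_distrib]
        simp
    _ ≤ ∑ t ∈ Finset.range T, (c * J t + 4 * d t + if t = 0 then 2 else 0) :=
        Finset.sum_le_sum hround
    _ = c * ∑ t ∈ Finset.range T, J t + 4 * ∑ t ∈ Finset.range T, d t +
          ∑ t ∈ Finset.range T, (if t = 0 then (2 : ℝ) else 0) := by
        rw [Finset.sum_add_distrib, Finset.sum_add_distrib, Finset.mul_sum, Finset.mul_sum]
    _ ≤ _ := by
        have := mul_le_mul_of_nonneg_left hJsum hc0
        linarith

end IsAuctionModel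

end FirstPrice

/-! ### Choice of the grid ratio and of the constant. -/

theorem mainTheorem4
    (γ : ℝ) (hγ : 1 < γ)
    (μ : MeasureTheory.Measure ℝ) [MeasureTheory.IsProbabilityMeasure μ]
    (hμ : μ (Set.Icc 0 1) = 1)
    (v bstar : ℝ)
    (hb : IsGreatest (FirstPrice.argmaxBids (ProbabilityTheory.cdf μ) v) bstar)
    (hF : 0 < ProbabilityTheory.cdf μ bstar) :
    ∃ C : ℝ, ∀ (Ω : Type*) [MeasurableSpace Ω] (P : MeasureTheory.Measure Ω)
      [MeasureTheory.IsProbabilityMeasure P] (V M : ℕ → Ω → ℝ),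
      (∀ t, Measurable (V t)) → (∀ t, Measurable (M t)) →
      -- all the values and all the opposing bids are mutually independent
      ProbabilityTheory.iIndepFun (Sum.elim V M) P →
      (∀ t, ProbabilityTheory.IdentDistrib (V t) (V 0) P P) →
      (∀ t, ∀ᵐ ω ∂P, V t ω ∈ Set.Icc (0 : ℝ) 1) →
      (∀ t, ∫ ω, V t ω ∂P = v) →
      (∀ t, P.map (M t) = μ) →
      ∀ T : ℕ, 2 ≤ T →
        FirstPrice.regret P (ProbabilityTheory.cdf μ) v
            (fun t ω => FirstPrice.ucbid1 (ProbabilityTheory.cdf μ) γ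
              (fun s => V s ω) (fun s => M s ω) t) T
          ≤ √(2 * γ) / ProbabilityTheory.cdf μ bstar * √(T * Real.log T)
            + C * Real.log T := by
  -- Chosen so that `γ(1 - s²) = (γ + 1)/2`, the midpoint of `1` and `γ`.
  set s := √((γ - 1) / (2 * γ)) with hs
  have hpos : 0 < (γ - 1) / (2 * γ) := div_pos (by linarith) (by linarith)
  have hs0 : 0 < s := Real.sqrt_pos.2 hpos
  have hs1 : 1 < γ * (1 - s ^ 2) := by
    have : γ * (1 - s ^ 2) = (γ + 1) / 2 := by
      rw [hs, Real.sq_sqrt hpos.le]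
      field_simp
      ring
    linarith
  set D := 2 + 4 * ∑' t : ℕ, (Real.log t / Real.log (1 + s) + 1) *
    (t : ℝ) ^ (-(γ * (1 - s ^ 2))) with hD
  have hD0 : 0 ≤ D := by
    have hq : 0 < Real.log (1 + s) := Real.log_pos (by linarith)
    have : 0 ≤ ∑' t : ℕ, (Real.log t / Real.log (1 + s) + 1) *
        (t : ℝ) ^ (-(γ * (1 - s ^ 2))) := tsum_nonneg fun t => by
      have := Real.log_natCast_nonneg t
      positivity
    linarith
  -- The remainder `D` depends on `γ` alone; dividing by `log 2` absorbs it into `log T` for `T ≥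
  -- 2`.
  refine ⟨D / Real.log 2, fun Ω _ P _ V M hV hM hind _ hV01 hmean hlaw T hT => ?_⟩
  have A : FirstPrice.IsAuctionModel P V M v μ := ⟨hV, hM, hind, hV01, hmean, hlaw⟩
  refine (A.regret_ucbid1_le hμ (by linarith) hs0 hs1 hb hF T).trans ?_
  have hlog2 : 0 < Real.log 2 := Real.log_pos one_lt_two
  have hlog : Real.log 2 ≤ Real.log T := Real.log_le_log two_pos (by exact_mod_cast hT)
  have : D ≤ D / Real.log 2 * Real.log T := by
    rw [div_mul_eq_mul_div, le_div_iff₀ hlog2]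
    exact mul_le_mul_of_nonneg_left hlog hD0
  linarith
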